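/- Notation. A Boolean function is a function $f\colon\{0,1\}^n\to\{0,1\}$ with $n$ a positive integer, and $\neg f = 1-f$. - $D(f)$ is the minimum depth of a deterministic decision tree that computes $f(x)$ exactly for all $x\in\{0,1\}^n$ by querying bits of $x$. - $\mathrm{ndeg}(f)$ is the minimum degree of a multilinear polynomial $p\in\mathbb{R}[X_1,\dots,X_n]$ such that, for all $x\in\{0,1\}^n$, $p(x)\neq 0$ if and only if $f(x)=1$. - For $\epsilon\in[0,1)$, $\mathrm{ndeg}_\epsilon(f)$ is the minimum degree of a polynomial $p\in\mathbb{R}[X_1,\dots,X_n]$ such that, for all $x\in\{0,1\}^n$, $|p(x)|\le\epsilon$ if $f(x)=0$ and $|p(x)|\ge 1$ if $f(x)=1$. (The degree of the zero polynomial is taken to be $0$.) Theorem. For every $\epsilon\in[0,1)$ there is a constant $C$, depending only on $\epsilon$, such that for every positive integer $n$ and every Boolean function $f\colon\{0,1\}^n\to\{0,1\}$, $$D(f)\le C\cdot \mathrm{ndeg}_\epsilon(f)^2\,\mathrm{ndeg}(\neg f)^2\quad\text{and}\quad D(f)\le C\cdot \mathrm{ndeg}(f)^2\,\mathrm{ndeg}_\epsilon(\neg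 f)^2 .$$ -/

import Mathlib

noncomputable section

namespace BooleanComplexity

/-- A Boolean function `{0,1}^n → {0,1}`; `true` stands for `1` and `false` for `0`. -/
abbrev BoolFun (n : ℕ) : Type := (Fin n → Bool) → Bool

/-- The negation `¬f` of a Boolean function. -/
def neg {n : ℕ} (f : BoolFun n) : BoolFun n := fun x => !(f x)

/-- The point of `{0,1}^n ⊆ ℝ^n` given by a bit string. -/
def point {n : ℕ} (x : Fin n → Bool) : Fin n → ℝ := fun i => if x i then 1 else 0

/-- A real polynomial is multilinear if every variable has degree at most one in it. -/
def IsMultilinear {n : ℕ} (p : MvPolynomial (Fin n) ℝ) : Prop := ∀ i, p.degreeOf i ≤ 1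

/-- `p` is a nondeterministic representation of `f`: it is multilinear and, on the cube,
it is nonzero exactly where `f` takes the value `1`. -/
def IsNondetRep {n : ℕ} (f : BoolFun n) (p : MvPolynomial (Fin n) ℝ) : Prop :=
  IsMultilinear p ∧ ∀ x, MvPolynomial.eval (point x) p ≠ 0 ↔ f x = true

/-- The nondeterministic degree: the minimum degree of a nondeterministic representation. -/
def ndeg {n : ℕ} (f : BoolFun n) : ℕ :=
  sInf {d | ∃ p : MvPolynomial (Fin n) ℝ, IsNondetRep f p ∧ p.totalDegree = d}

/-- `p` is an `ε`-approximate nondeterministic representation of `f`: on the cube, `|p| ≤ ε`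
where `f` is `0`, and `|p| ≥ 1` where `f` is `1`. -/
def IsApproxNondetRep {n : ℕ} (ε : ℝ) (f : BoolFun n) (p : MvPolynomial (Fin n) ℝ) : Prop :=
  ∀ x, (f x = false → |MvPolynomial.eval (point x) p| ≤ ε) ∧
    (f x = true → 1 ≤ |MvPolynomial.eval (point x) p|)

/-- The `ε`-approximate nondeterministic degree: the minimum degree of a real polynomial that
is an `ε`-approximate nondeterministic representation. -/
def approxNdeg {n : ℕ} (ε : ℝ) (f : BoolFun n) : ℕ :=
  sInf {d | ∃ p : MvPolynomial (Fin n) ℝ, IsApproxNondetRep ε f p ∧ p.totalDegree = d}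

/-- Deterministic decision trees over `n` input bits. -/
inductive DecisionTree (n : ℕ) : Type
  | leaf (b : Bool) : DecisionTree n
  | query (i : Fin n) (ifZero ifOne : DecisionTree n) : DecisionTree n

/-- The output of a decision tree on an input. -/
def DecisionTree.eval {n : ℕ} (x : Fin n → Bool) : DecisionTree n → Bool
  | .leaf b => b
  | .query i s t => if x i then t.eval x else s.eval x

/-- The depth: the maximum number of queries on a path from the root to a leaf. -/
def DecisionTree.depth {n : ℕ} : DecisionTree n → ℕ
  | .leaf _ => 0
  | .query _ s t => max s.depth t.depth + 1

/-- The tree computes `f` exactly on every input. -/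
def DecisionTree.Computes {n : ℕ} (T : DecisionTree n) (f : BoolFun n) : Prop :=
  ∀ x, T.eval x = f x

/-- Decision tree complexity `D(f)`: the minimum depth of a decision tree computing `f`. -/
def D {n : ℕ} (f : BoolFun n) : ℕ :=
  sInf {d | ∃ T : DecisionTree n, T.Computes f ∧ T.depth = d}

/-! The three minima above are over nonempty sets, for every Boolean function. -/

/-- Every Boolean function agrees on the cube with a multilinear polynomial. -/
theorem exists_multilinear {n : ℕ} (f : BoolFun n) :
    ∃ p : MvPolynomial (Fin n) ℝ, IsMultilinear p ∧
      ∀ x, MvPolynomial.eval (point x) p = if f x then 1 else 0 := by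
  classical
  let g : (Fin n → Bool) → Fin n → MvPolynomial (Fin n) ℝ := fun y j =>
    if y j then MvPolynomial.X j else 1 - MvPolynomial.X j
  have hg : ∀ y i j, (g y j).degreeOf i ≤ if j = i then 1 else 0 := by
    intro y i j
    have hX : (MvPolynomial.X j : MvPolynomial (Fin n) ℝ).degreeOf i ≤ if j = i then 1 else 0 := by
      rw [MvPolynomial.degreeOf_X]
      simp [eq_comm]
    by_cases hy : y j
    · simpa [g, hy] using hX
    · simp only [g, hy]
      refine (MvPolynomial.degreeOf_sub_le i _ _).trans (max_le ?_ hX)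
      simp [MvPolynomial.degreeOf_one]
  refine ⟨∑ y with f y = true, ∏ j, g y j, ?_, ?_⟩
  · intro i
    refine (MvPolynomial.degreeOf_sum_le i _ _).trans (Finset.sup_le fun y _ => ?_)
    refine (MvPolynomial.degreeOf_prod_le i _ _).trans ?_
    refine (Finset.sum_le_sum fun j _ => hg y i j).trans ?_
    simp
  · intro x
    have hev : ∀ y, MvPolynomial.eval (point x) (∏ j, g y j) = if y = x then 1 else 0 := by
      intro y
      rw [map_prod]
      have : ∀ j, MvPolynomial.eval (point x) (g y j) = if y j = x j then 1 else 0 := by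
        intro j
        cases hy : y j <;> cases hx : x j <;> simp [g, point, hy, hx]
      simp only [this, Finset.prod_ite_zero, funext_iff]
      simp
    rw [map_sum]
    simp [hev]

theorem exists_nondetRep {n : ℕ} (f : BoolFun n) :
    ∃ p : MvPolynomial (Fin n) ℝ, IsNondetRep f p := by
  obtain ⟨p, hp, h⟩ := exists_multilinear f
  exact ⟨p, hp, fun x => by rw [h x]; simp⟩

theorem exists_approxNondetRep {n : ℕ} {ε : ℝ} (hε : 0 ≤ ε) (f : BoolFun n) :
    ∃ p : MvPolynomial (Fin n) ℝ, IsApproxNondetRep ε f p := by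
  obtain ⟨p, -, h⟩ := exists_multilinear f
  refine ⟨p, fun x => ⟨fun hx => ?_, fun hx => ?_⟩⟩ <;> rw [h x] <;> simp [hx, hε]

theorem exists_decisionTree {n : ℕ} (f : BoolFun n) :
    ∃ T : DecisionTree n, T.Computes f := by
  classical
  suffices H : ∀ (s : Finset (Fin n)) (z : Fin n → Bool), ∃ T : DecisionTree n,
      ∀ x, (∀ i, i ∉ s → x i = z i) → T.eval x = f x by
    obtain ⟨T, hT⟩ := H Finset.univ fun _ => false
    exact ⟨T, fun x => hT x fun i hi => absurd (Finset.mem_univ i) hi⟩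
  intro s
  induction s using Finset.induction_on with
  | empty =>
    intro z
    refine ⟨.leaf (f z), fun x hx => ?_⟩
    have : x = z := funext fun i => hx i (Finset.notMem_empty i)
    simp [DecisionTree.eval, this]
  | insert a s _ ih =>
    intro z
    obtain ⟨T0, h0⟩ := ih (Function.update z a false)
    obtain ⟨T1, h1⟩ := ih (Function.update z a true)
    refine ⟨.query a T0 T1, fun x hx => ?_⟩
    have key : ∀ b, x a = b → ∀ i, i ∉ s → x i = Function.update z a b i := by
      intro b hb i hi
      by_cases hia : i = a
      · subst hia; simp [hb]
      · rw [Function.update_of_ne hia]; exact hx i (by simp [hia, hi])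
    cases hxa : x a
    · simpa [DecisionTree.eval, hxa] using h0 x (key _ hxa)
    · simpa [DecisionTree.eval, hxa] using h1 x (key _ hxa)

end BooleanComplexity

end

/-! Let `p`, of degree `d`, approximate `f`, and let `q`, of degree `k`, be a nondeterministic
representation of `neg f`. On a subcube where `f` is not identically 0, take the 1-input `x`
maximising `|p|`. Flip disjoint sensitive blocks of `x` independently with probability `t`. The
expected value of `p` is a polynomial in `t` of degree at most `d`, bounded by `|p(x)|` on [0, 1],
and its derivative at 0 has modulus at least `(1 - ε) * |p(x)|` times the number of blocks. Markov's
inequality therefore allows at most `N = ⌊2d² / (1 - ε)⌋` blocks (`card_blocks_le`).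

Every top-degree monomial of `q` contains a sensitive block of `x`, because it survives fixing all
other variables (`exists_multilin_ne_zero`). So a maximal disjoint family of such monomials has at
most `N` members. Querying their variables costs at most `N * k` and lowers the degree of `q`;
iterating gives depth at most `k² * N` (`exists_decisionTree_depth_le`). -/

noncomputable section
namespace BooleanComplexity

open Finset

/-! ### Multilinear forms on the cube -/

/-- The function on the cube given by the multilinear polynomial with coefficients `c`. -/
def multilin {n : ℕ} (c : Finset (Fin n) → ℝ) (x : Fin n → Bool) : ℝ :=
  ∑ S, c S * ∏ i ∈ S, point x i

/-- Powers of a bit equal the bit, so monomials with the same support merge. This matters for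
approximate representations, which need not be multilinear. -/
theorem exists_multilin_eq_eval {n : ℕ} (p : MvPolynomial (Fin n) ℝ) :
    ∃ c : Finset (Fin n) → ℝ, (∀ S, c S ≠ 0 → #S ≤ p.totalDegree) ∧
      ∀ x, MvPolynomial.eval (point x) p = multilin c x := by
  classical
  refine ⟨fun S => ∑ m ∈ p.support with m.support = S, p.coeff m, fun S hS => ?_, fun x => ?_⟩
  · obtain ⟨m, hm, -⟩ := exists_ne_zero_of_sum_ne_zero hS
    rw [mem_filter] at hm
    rw [← hm.2]
    refine le_trans ?_ (MvPolynomial.le_totalDegree hm.1)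
    rw [Finsupp.sum, card_eq_sum_ones]
    exact sum_le_sum fun i hi => Nat.one_le_iff_ne_zero.2 (Finsupp.mem_support_iff.1 hi)
  · rw [MvPolynomial.eval_eq, multilin, ← sum_fiberwise p.support (fun m => m.support)]
    refine sum_congr rfl fun S _ => ?_
    rw [sum_mul]
    refine sum_congr rfl fun m hm => ?_
    rw [← (mem_filter.1 hm).2]
    congr 1
    refine prod_congr rfl fun i hi => ?_
    have := Finsupp.mem_support_iff.1 hi
    by_cases h : x i <;> simp [point, h, this]

/-- A monomial of maximal size survives every restriction of the other variables. -/
theorem exists_multilin_ne_zero {n : ℕ} {c : Finset (Fin n) → ℝ} {M : Finset (Fin n)}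
    (hM : c M ≠ 0) (hmax : ∀ S, c S ≠ 0 → #S ≤ #M) (x : Fin n → Bool) :
    ∃ y, (∀ i, i ∉ M → y i = x i) ∧ multilin c y ≠ 0 := by
  classical
  by_contra! H
  let y : Finset (Fin n) → Fin n → Bool := fun A i => if i ∈ M then decide (i ∈ A) else x i
  have hy : ∀ A, multilin c (y A) = 0 := fun A => H _ fun i hi => by simp [y, hi]
  -- Möbius inversion over the subsets of `M`: the alternating sum kills every monomial not
  -- containing `M`, and by maximality only `M` itself then contributes.
  have key : ∀ S, ∑ A ∈ M.powerset, (-1 : ℝ) ^ #(M \ A) * ∏ i ∈ S, point (y A) i =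
      if M ⊆ S then ∏ i ∈ S \ M, point x i else 0 := by
    intro S
    have h1 : ∀ A ∈ M.powerset, (-1 : ℝ) ^ #(M \ A) * ∏ i ∈ S, point (y A) i =
        (∏ i ∈ S \ M, point x i) *
          ((∏ i ∈ A, 1) * ∏ i ∈ M \ A, (if i ∈ S then (0 : ℝ) else -1)) := by
      intro A hA
      rw [mem_powerset] at hA
      have e1 : ∏ i ∈ S, point (y A) i =
          (∏ i ∈ S \ M, point x i) * ∏ i ∈ S ∩ M, if i ∈ A then (1 : ℝ) else 0 := by
        rw [← prod_sdiff (inter_subset_left : S ∩ M ⊆ S), sdiff_inter_self_left]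
        congr 1
        · exact prod_congr rfl fun i hi => by simp [point, y, (mem_sdiff.1 hi).2]
        · exact prod_congr rfl fun i hi => by simp [point, y, (mem_inter.1 hi).2]
      rw [e1]
      have e2 : (-1 : ℝ) ^ #(M \ A) * ∏ i ∈ S ∩ M, (if i ∈ A then (1 : ℝ) else 0) =
          ∏ i ∈ M \ A, (if i ∈ S then (0 : ℝ) else -1) := by
        by_cases h : ∃ i ∈ M \ A, i ∈ S
        · obtain ⟨i, hi, hiS⟩ := h
          rw [prod_eq_zero hi (by simp [hiS]),
            prod_eq_zero (i := i) (by simp_all) (by simp_all), mul_zero]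
        · push Not at h
          have h' : ∏ i ∈ M \ A, (if i ∈ S then (0 : ℝ) else -1) = (-1) ^ #(M \ A) := by
            rw [← prod_const]
            exact prod_congr rfl fun i hi => by rw [if_neg (h i hi)]
          rw [h', prod_eq_one, mul_one]
          intro i hi
          have : i ∈ A := by
            by_contra hA'
            exact h i (mem_sdiff.2 ⟨(mem_inter.1 hi).2, hA'⟩) (mem_inter.1 hi).1
          simp [this]
      rw [← e2]
      simp
      ring
    rw [sum_congr rfl h1, ← mul_sum, ← prod_add]
    split_ifs with hMS
    · rw [prod_eq_one (s := M), mul_one]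
      intro i hi
      simp [hMS hi]
    · obtain ⟨i, hi, hiS⟩ := not_subset.1 hMS
      rw [prod_eq_zero hi (by simp [hiS]), mul_zero]
  have h0 : ∑ A ∈ M.powerset, (-1 : ℝ) ^ #(M \ A) * multilin c (y A) = 0 := by simp [hy]
  refine hM ?_
  rw [← h0]
  simp only [multilin, mul_sum]
  rw [sum_comm, sum_eq_single M]
  · have := key M
    simp only [subset_refl, if_true, sdiff_self, bot_eq_empty, prod_empty] at this
    calc c M = c M * ∑ A ∈ M.powerset, (-1 : ℝ) ^ #(M \ A) * ∏ i ∈ M, point (y A) i := by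
          rw [this, mul_one]
      _ = _ := by rw [mul_sum]; exact sum_congr rfl fun A _ => by ring
  · intro S _ hS
    have : ∑ A ∈ M.powerset, (-1 : ℝ) ^ #(M \ A) * (c S * ∏ i ∈ S, point (y A) i) =
        c S * if M ⊆ S then ∏ i ∈ S \ M, point x i else 0 := by
      rw [← key, mul_sum]; exact sum_congr rfl fun A _ => by ring
    rw [this]
    by_cases hc : c S = 0
    · simp [hc]
    · rw [if_neg, mul_zero]
      exact fun h => hS (eq_of_subset_of_card_le h (hmax S hc)).symm
  · simp

/-- Fixing the variables in `H` to the values given by `z`. -/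
theorem exists_multilin_restrict {n : ℕ} (c : Finset (Fin n) → ℝ) (H : Finset (Fin n))
    (z : Fin n → Bool) :
    ∃ c' : Finset (Fin n) → ℝ, (∀ S', c' S' ≠ 0 → ∃ S, c S ≠ 0 ∧ S \ H = S') ∧
      ∀ x, (∀ i ∈ H, x i = z i) → multilin c x = multilin c' x := by
  classical
  refine ⟨fun S' => ∑ S with S \ H = S', c S * ∏ i ∈ S ∩ H, point z i, fun S' hS' => ?_,
    fun x hx => ?_⟩
  · obtain ⟨S, hS, h⟩ := exists_ne_zero_of_sum_ne_zero hS'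
    exact ⟨S, left_ne_zero_of_mul h, (mem_filter.1 hS).2⟩
  · rw [multilin, multilin, ← sum_fiberwise univ (fun S => S \ H)]
    refine sum_congr rfl fun S' _ => ?_
    rw [sum_mul]
    refine sum_congr rfl fun S hS => ?_
    rw [← (mem_filter.1 hS).2, mul_assoc]
    congr 1
    rw [← prod_sdiff (inter_subset_left : S ∩ H ⊆ S), sdiff_inter_self_left, mul_comm]
    congr 1
    exact prod_congr rfl fun i hi => by simp [point, hx i (mem_inter.1 hi).2]

/-! ### Markov's inequality -/

open Polynomial in
/-- **Markov's inequality** at an endpoint of `[0, 1]`. -/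
theorem abs_eval_derivative_zero_le {P : ℝ[X]} {d : ℕ} {M : ℝ} (hd : P.natDegree ≤ d)
    (hM : 0 < M) (hP : ∀ t ∈ Set.Icc (0 : ℝ) 1, |P.eval t| ≤ M) :
    |(derivative P).eval 0| ≤ 2 * d ^ 2 * M := by
  have key : ∀ a : ℝ, |a| = M⁻¹ → a * (derivative P).eval 0 ≤ 2 * d ^ 2 := by
    intro a ha
    -- The map `u ↦ (1 - u) / 2` carries [-1, 1] to [0, 1] and 1 to 0, so the Chebyshev bound
    -- `T_d'(1) = d²` applies; its slope -1/2 produces the factor 2 and the sign in `-a`.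
    let Q : ℝ[X] := C (-a) * P.comp (C (1 / 2) * (1 - X))
    have hQd : Q.degree ≤ d := by
      refine natDegree_le_iff_degree_le.1 ((natDegree_C_mul_le _ _).trans ?_)
      refine natDegree_comp_le.trans ?_
      have : (C (1 / 2 : ℝ) * (1 - X)).natDegree ≤ 1 := by compute_degree
      calc _ ≤ d * 1 := Nat.mul_le_mul hd this
        _ = d := mul_one d
    have hQ := Chebyshev.eval_iterate_derivative_le_of_forall_abs_le_one (k := 1) (P := Q)
      (le_refl (1 : ℝ)) hQd (by
        intro t ht
        have h1 := hP ((1 - t) / 2) ⟨by linarith [ht.2], by linarith [ht.1]⟩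
        have : Q.eval t = -a * P.eval ((1 - t) / 2) := by
          simp [Q, eval_comp]; left; congr 1; ring
        rw [this, abs_mul, abs_neg, ha]
        rw [inv_mul_le_iff₀ hM]; linarith)
    have hT : (derivative (Chebyshev.T ℝ d)).eval 1 = (d : ℝ) ^ 2 := by
      simp [Chebyshev.derivative_T_eval_one]
    rw [Function.iterate_one, hT] at hQ
    have hQ' : (derivative Q).eval 1 = a * (derivative P).eval 0 / 2 := by
      simp [Q, derivative_comp, eval_comp]; ring
    rw [hQ'] at hQ
    linarith
  have h1 := key M⁻¹ (abs_of_pos (inv_pos.2 hM))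
  have h2 := key (-M⁻¹) (by rw [abs_neg, abs_of_pos (inv_pos.2 hM)])
  rw [inv_mul_le_iff₀ hM] at h1
  rw [neg_mul, ← mul_neg, inv_mul_le_iff₀ hM] at h2
  rw [abs_le]
  constructor <;> linarith

/-! ### Querying a set of variables -/

/-- Querying all variables of `H` before continuing with a tree chosen by the answers. -/
theorem exists_decisionTree_query_all {n : ℕ} {f : BoolFun n} {m : ℕ} (s H : Finset (Fin n)) :
    ∀ z : Fin n → Bool,
      (∀ z' : Fin n → Bool, (∀ i, i ∉ H → z' i = z i) → ∃ T : DecisionTree n, T.depth ≤ m ∧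
        ∀ x, (∀ i, i ∉ s → x i = z' i) → T.eval x = f x) →
      ∃ T : DecisionTree n, T.depth ≤ #H + m ∧
        ∀ x, (∀ i, i ∉ s → i ∉ H → x i = z i) → T.eval x = f x := by
  classical
  induction H using Finset.induction_on with
  | empty =>
    intro z h
    obtain ⟨T, hT, hTf⟩ := h z fun _ _ => rfl
    exact ⟨T, by simpa using hT, fun x hx => hTf x fun i hi => hx i hi (notMem_empty i)⟩
  | insert a H ha ih =>
    intro z h
    have step : ∀ b, ∃ T : DecisionTree n, T.depth ≤ #H + m ∧
        ∀ x, (∀ i, i ∉ s → i ∉ H → x i = Function.update z a b i) → T.eval x = f x := by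
      intro b
      refine ih _ fun z' hz' => h z' fun i hi => ?_
      rw [mem_insert, not_or] at hi
      rw [hz' i hi.2, Function.update_of_ne hi.1]
    obtain ⟨T0, hd0, h0⟩ := step false
    obtain ⟨T1, hd1, h1⟩ := step true
    refine ⟨.query a T0 T1, ?_, fun x hx => ?_⟩
    · rw [DecisionTree.depth, card_insert_of_notMem ha]
      omega
    · have key : ∀ b, x a = b → ∀ i, i ∉ s → i ∉ H → x i = Function.update z a b i := by
        intro b hb i hi hiH
        by_cases hia : i = a
        · subst hia; simp [hb]
        · rw [Function.update_of_ne hia]; exact hx i hi (by simp [hia, hiH])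
      cases hxa : x a
      · simpa [DecisionTree.eval, hxa] using h0 x (key _ hxa)
      · simpa [DecisionTree.eval, hxa] using h1 x (key _ hxa)


/-! ### Random block flips -/

/-- The input `x` with all bits in `A` flipped. -/
def flip {n : ℕ} (x : Fin n → Bool) (A : Finset (Fin n)) : Fin n → Bool :=
  fun i => if i ∈ A then !x i else x i

open Polynomial in
/-- The expectation of a multilinear form when disjoint blocks of bits are flipped independently
with probability `t` is a polynomial in `t` of no larger degree. -/
theorem natDegree_sum_flip_le {n d : ℕ} {ι : Type*} [DecidableEq ι] {c : Finset (Fin n) → ℝ}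
    (hc : ∀ S, c S ≠ 0 → #S ≤ d) (x : Fin n → Bool) (F : Finset ι) (B : ι → Finset (Fin n))
    (hB : (F : Set ι).PairwiseDisjoint B) :
    (∑ A ∈ F.powerset, C (multilin c (flip x (A.biUnion B))) * (X ^ #A * (1 - X) ^ #(F \ A)) :
      ℝ[X]).natDegree ≤ d := by
  classical
  have key : ∀ S : Finset (Fin n),
      (∑ A ∈ F.powerset, C (∏ i ∈ S, point (flip x (A.biUnion B)) i) *
        (X ^ #A * (1 - X) ^ #(F \ A)) : ℝ[X]) =
      C (∏ i ∈ S \ F.biUnion B, point x i) *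
        ∏ j ∈ F, (X * C (∏ i ∈ S ∩ B j, point (fun i => !x i) i) +
          (1 - X) * C (∏ i ∈ S ∩ B j, point x i)) := by
    intro S
    rw [prod_add, mul_sum]
    refine sum_congr rfl fun A hA => ?_
    rw [mem_powerset] at hA
    have hS : ∏ i ∈ S, point (flip x (A.biUnion B)) i = (∏ i ∈ S \ F.biUnion B, point x i) *
        ((∏ j ∈ A, ∏ i ∈ S ∩ B j, point (fun i => !x i) i) *
          ∏ j ∈ F \ A, ∏ i ∈ S ∩ B j, point x i) := by
      rw [← prod_sdiff (inter_subset_left : S ∩ F.biUnion B ⊆ S), sdiff_inter_self_left,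
        inter_biUnion, prod_biUnion (fun i hi j hj hij =>
          (hB hi hj hij).mono inter_subset_right inter_subset_right), ← prod_sdiff hA,
        mul_comm (∏ j ∈ F \ A, _)]
      congr 1
      · refine prod_congr rfl fun i hi => ?_
        have : i ∉ A.biUnion B := fun h => (mem_sdiff.1 hi).2 (biUnion_subset_biUnion_of_subset_left B hA h)
        simp only [point, flip, if_neg this]
      · congr 1
        · refine prod_congr rfl fun j hj => prod_congr rfl fun i hi => ?_
          have : i ∈ A.biUnion B := mem_biUnion.2 ⟨j, hj, (mem_inter.1 hi).2⟩
          simp only [point, flip, if_pos this]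
        · refine prod_congr rfl fun j hj => prod_congr rfl fun i hi => ?_
          have : i ∉ A.biUnion B := by
            intro h
            obtain ⟨j', hj', hi'⟩ := mem_biUnion.1 h
            have hne : j ≠ j' := fun h => (mem_sdiff.1 hj).2 (h ▸ hj')
            exact disjoint_left.1 (hB (mem_sdiff.1 hj).1 (hA hj') hne) (mem_inter.1 hi).2 hi'
          simp only [point, flip, if_neg this]
    rw [hS, prod_mul_distrib, prod_mul_distrib, prod_const, prod_const]
    simp only [map_mul, map_prod]
    ring
  have hsum : (∑ A ∈ F.powerset, C (multilin c (flip x (A.biUnion B))) *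
      (X ^ #A * (1 - X) ^ #(F \ A)) : ℝ[X]) =
      ∑ S, C (c S) * ∑ A ∈ F.powerset, C (∏ i ∈ S, point (flip x (A.biUnion B)) i) *
        (X ^ #A * (1 - X) ^ #(F \ A)) := by
    simp only [multilin, map_sum, sum_mul, mul_sum, map_mul, mul_assoc]
    rw [sum_comm]
  rw [hsum]
  refine natDegree_sum_le_of_forall_le _ _ fun S _ => ?_
  by_cases h : c S = 0
  · simp [h]
  rw [key]
  refine (natDegree_C_mul_le _ _).trans ((natDegree_C_mul_le _ _).trans ?_)
  refine (natDegree_prod_le _ _).trans ?_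
  calc _ ≤ ∑ j ∈ F, #(S ∩ B j) := by
        -- A block missing `S` gives the factor `X + (1 - X) = 1`; every other block gives a linear
        -- factor and uses up a variable of `S`.
        refine sum_le_sum fun j _ => ?_
        rcases eq_or_ne (S ∩ B j) ∅ with h0 | h0
        · simp [h0]
        · refine le_trans ?_ (card_pos.2 (nonempty_iff_ne_empty.2 h0))
          generalize (∏ i ∈ S ∩ B j, point x i) = a
          generalize (∏ i ∈ S ∩ B j, point (fun i => !x i) i) = b
          compute_degree
    _ = #(F.biUnion fun j => S ∩ B j) := by
        rw [card_biUnion]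
        exact fun i hi j hj hij => (hB hi hj hij).mono inter_subset_right inter_subset_right
    _ ≤ #S := card_le_card (biUnion_subset.2 fun j _ => inter_subset_left)
    _ ≤ d := hc S h

open Polynomial in
/-- A multilinear form of degree `d` with its maximum modulus at `x` has at most
`2 d² / (1 - ε)` disjoint blocks whose flip decreases the modulus by a factor `ε`. -/
theorem card_blocks_le {n d : ℕ} {ι : Type*} [DecidableEq ι] {c : Finset (Fin n) → ℝ} {ε : ℝ}
    (hc : ∀ S, c S ≠ 0 → #S ≤ d) {x : Fin n → Bool} {F : Finset ι} {B : ι → Finset (Fin n)}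
    (hB : (F : Set ι).PairwiseDisjoint B) (hx : 0 < |multilin c x|)
    (hmax : ∀ A ⊆ F, |multilin c (flip x (A.biUnion B))| ≤ |multilin c x|)
    (hε : ∀ j ∈ F, |multilin c (flip x (B j))| ≤ ε * |multilin c x|) :
    #F * (1 - ε) ≤ 2 * d ^ 2 := by
  classical
  set g : Finset ι → ℝ := fun A => multilin c (flip x (A.biUnion B)) with hg
  set M := |multilin c x| with hM
  set P : ℝ[X] := ∑ A ∈ F.powerset, C (g A) * (X ^ #A * (1 - X) ^ #(F \ A)) with hP
  have hdeg : P.natDegree ≤ d := natDegree_sum_flip_le hc x F B hB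
  have hbd : ∀ t ∈ Set.Icc (0 : ℝ) 1, |P.eval t| ≤ M := by
    intro t ht
    have hw : ∀ A : Finset ι, 0 ≤ t ^ #A * (1 - t) ^ #(F \ A) := fun A =>
      mul_nonneg (pow_nonneg ht.1 _) (pow_nonneg (by linarith [ht.2]) _)
    have h1 : ∑ A ∈ F.powerset, t ^ #A * (1 - t) ^ #(F \ A) = 1 := by
      have := prod_add (fun _ => t) (fun _ => 1 - t) F
      simpa using this.symm
    calc |P.eval t| = |∑ A ∈ F.powerset, g A * (t ^ #A * (1 - t) ^ #(F \ A))| := by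
          simp [hP, eval_finsetSum]
      _ ≤ ∑ A ∈ F.powerset, |g A * (t ^ #A * (1 - t) ^ #(F \ A))| := abs_sum_le_sum_abs _ _
      _ ≤ ∑ A ∈ F.powerset, M * (t ^ #A * (1 - t) ^ #(F \ A)) := by
          refine sum_le_sum fun A hA => ?_
          rw [abs_mul, abs_of_nonneg (hw A)]
          exact mul_le_mul_of_nonneg_right (hmax A (mem_powerset.1 hA)) (hw A)
      _ = M := by rw [← mul_sum, h1, mul_one]
  have hmarkov := abs_eval_derivative_zero_le hdeg hx hbd
  have hder : (derivative P).eval 0 = ∑ j ∈ F, g {j} - #F * g ∅ := by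
    -- To first order in `t` at most one block is flipped.
    have hterm : ∀ A ∈ F.powerset,
        (derivative (C (g A) * (X ^ #A * (1 - X) ^ #(F \ A)) : ℝ[X])).eval 0 =
          (if #A = 1 then g A else 0) - (if A = ∅ then #F * g ∅ else 0) := by
      intro A _
      rcases Nat.lt_trichotomy (#A) 1 with h | h | h
      · have : A = ∅ := by rwa [Nat.lt_one_iff, card_eq_zero] at h
        subst this
        simp [derivative_pow]
        ring
      · have : A ≠ ∅ := by rintro rfl; simp at h
        simp [h, this]
      · have h1 : #A ≠ 1 := h.ne'
        have h2 : A ≠ ∅ := by rintro rfl; simp at h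
        have h3 : #A - 1 ≠ 0 := by omega
        have h4 : #A ≠ 0 := by omega
        simp [h1, h2, h3, h4, derivative_pow]
    rw [hP, derivative_sum, eval_finsetSum, sum_congr rfl hterm, sum_sub_distrib]
    congr 1
    · rw [← sum_filter, ← powersetCard_eq_filter, powersetCard_one, sum_map]
      rfl
    · rw [sum_ite_eq' F.powerset ∅ (fun _ => (#F : ℝ) * g ∅), if_pos (empty_mem_powerset F)]
  have hge : g ∅ = multilin c x := by
    have : flip x ∅ = x := by funext i; simp [flip]
    simp [hg, this]
  have hup : |∑ j ∈ F, g {j}| ≤ #F * (ε * M) := by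
    refine (abs_sum_le_sum_abs _ _).trans ?_
    rw [← nsmul_eq_mul]
    refine sum_le_card_nsmul _ _ _ fun j hj => ?_
    simpa [hg] using hε j hj
  have hlow : #F * M - #F * (ε * M) ≤ |(derivative P).eval 0| := by
    rw [hder, abs_sub_comm]
    refine le_trans ?_ (abs_sub_abs_le_abs_sub _ _)
    rw [abs_mul, hge, Nat.abs_cast, ← hM]
    linarith
  refine le_of_mul_le_mul_right ?_ hx
  linarith

/-! ### One-inputs with few sensitive blocks -/

/-- Every subcube on which `f` is not constantly `0` contains a `1`-input of `f` with at most `N`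
disjoint sensitive blocks of variables of the subcube. -/
def HasOneInputs {n : ℕ} (N : ℕ) (f : BoolFun n) : Prop :=
  ∀ (s : Finset (Fin n)) (z : Fin n → Bool), (∃ x, (∀ i, i ∉ s → x i = z i) ∧ f x = true) →
    ∃ x, (∀ i, i ∉ s → x i = z i) ∧ f x = true ∧
      ∀ (F : Finset (Finset (Fin n))) (B : Finset (Fin n) → Finset (Fin n)),
        (F : Set (Finset (Fin n))).PairwiseDisjoint B → (∀ j ∈ F, B j ⊆ s) →
        (∀ j ∈ F, f (flip x (B j)) = false) → #F ≤ N

theorem hasOneInputs_of_approx {n d N : ℕ} {f : BoolFun n} {c : Finset (Fin n) → ℝ} {ε : ℝ}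
    (hε0 : 0 ≤ ε) (hε1 : ε < 1) (hc : ∀ S, c S ≠ 0 → #S ≤ d)
    (h0 : ∀ x, f x = false → |multilin c x| ≤ ε) (h1 : ∀ x, f x = true → 1 ≤ |multilin c x|)
    (hN : N = ⌊2 * (d : ℝ) ^ 2 / (1 - ε)⌋₊) : HasOneInputs N f := by
  classical
  intro s z hne
  obtain ⟨x, ⟨hxs, hx⟩, hmax⟩ := Set.exists_max_image
    {x : Fin n → Bool | (∀ i, i ∉ s → x i = z i) ∧ f x = true} (fun x => |multilin c x|) (Set.toFinite _) hne
  have hx1 := h1 x hx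
  refine ⟨x, hxs, hx, fun F B hB hBs hf => ?_⟩
  rw [hN]
  refine Nat.le_floor ?_
  rw [le_div_iff₀ (by linarith)]
  refine card_blocks_le hc hB (by linarith) (fun A hA => ?_) fun j hj => ?_
  -- A flipped input is either a 0-input, with modulus at most `ε < 1`, or a 1-input of the same
  -- subcube, where `x` is the maximiser.
  · rcases hfx : f (flip x (A.biUnion B)) with _ | _
    · linarith [h0 _ hfx]
    · refine hmax _ ⟨fun i hi => ?_, hfx⟩
      have : i ∉ A.biUnion B := by
        intro h
        obtain ⟨j, hj, hij⟩ := mem_biUnion.1 h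
        exact hi (hBs j (hA hj) hij)
      rw [flip, if_neg this, hxs i hi]
  · exact (h0 _ (hf j hj)).trans (le_mul_of_one_le_right hε0 hx1)

/-! ### The decision tree -/

theorem exists_maximal_pairwiseDisjoint {n : ℕ} (𝓜 : Finset (Finset (Fin n))) :
    ∃ F ⊆ 𝓜, (F : Set (Finset (Fin n))).PairwiseDisjoint id ∧
      ∀ S ∈ 𝓜, S.Nonempty → ∃ i ∈ S, i ∈ F.biUnion id := by
  classical
  obtain ⟨F, hF, hmax⟩ := exists_max_image
    (𝓜.powerset.filter fun F : Finset (Finset (Fin n)) => (F : Set (Finset (Fin n))).PairwiseDisjoint id) card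
    ⟨∅, by simp⟩
  simp only [mem_filter, mem_powerset] at hF hmax
  refine ⟨F, hF.1, hF.2, fun S hS hne => ?_⟩
  by_contra! H
  have hdisj : ∀ T ∈ F, Disjoint S T := fun T hT =>
    disjoint_left.2 fun i hi hiT => H i hi (mem_biUnion.2 ⟨T, hT, hiT⟩)
  have hSF : S ∉ F := fun h => hne.ne_empty (disjoint_self.1 (hdisj S h))
  have := hmax (insert S F) ⟨insert_subset hS hF.1, by
    rw [coe_insert]
    exact hF.2.insert fun T hT _ => hdisj T hT⟩
  rw [card_insert_of_notMem hSF] at this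
  omega

/-- Induction on the degree bound of a form `c` representing `neg f` on the current subcube, whose
free variables are `s`. -/
theorem exists_decisionTree_depth_le {n N : ℕ} {f : BoolFun n} (hN : HasOneInputs N f) (k : ℕ) :
    ∀ (s : Finset (Fin n)) (z : Fin n → Bool) (c : Finset (Fin n) → ℝ),
      (∀ S, c S ≠ 0 → S ⊆ s ∧ #S ≤ k) →
      (∀ x, (∀ i, i ∉ s → x i = z i) → (multilin c x ≠ 0 ↔ f x = false)) →
      ∃ T : DecisionTree n, T.depth ≤ k ^ 2 * N ∧
        ∀ x, (∀ i, i ∉ s → x i = z i) → T.eval x = f x := by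
  classical
  induction k with
  | zero =>
    intro s z c hc hf
    refine ⟨.leaf (f z), by simp [DecisionTree.depth], fun x hx => ?_⟩
    have hconst : ∀ y, multilin c y = c ∅ := by
      intro y
      rw [multilin, sum_eq_single ∅]
      · simp
      · intro S _ hS
        have : c S = 0 := by
          by_contra h
          exact hS (card_eq_zero.1 (Nat.le_zero.1 (hc S h).2))
        simp [this]
      · simp
    have h1 := hf x hx
    have h2 := hf z fun _ _ => rfl
    rw [hconst] at h1 h2
    rw [h1] at h2
    simp only [DecisionTree.eval]
    cases h : f x <;> cases h' : f z <;> simp_all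
  | succ k ih =>
    intro s z c hc hf
    by_cases hne : ∃ x, (∀ i, i ∉ s → x i = z i) ∧ f x = true
    swap
    · push Not at hne
      exact ⟨.leaf false, by simp [DecisionTree.depth], fun x hx => by
        simpa [DecisionTree.eval] using (hne x hx).symm⟩
    obtain ⟨x, hxs, hx, hbs⟩ := hN s z hne
    obtain ⟨F, hF, hdisj, hhit⟩ := exists_maximal_pairwiseDisjoint
      (univ.filter fun S => c S ≠ 0 ∧ #S = k + 1)
    have hF' : ∀ M ∈ F, c M ≠ 0 ∧ #M = k + 1 := fun M hM => by simpa using hF hM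
    have hex : ∀ M ∈ F, ∃ y, (∀ i, i ∉ M → y i = x i) ∧ multilin c y ≠ 0 := fun M hM =>
      exists_multilin_ne_zero (hF' M hM).1
        (fun S hS => (hF' M hM).2 ▸ (hc S hS).2) x
    choose! y hyM hy using hex
    have hcard : #F ≤ N := by
      -- The sensitive block inside `M` consists of the bits where `y M` and `x` differ.
      refine hbs F (fun M => M.filter fun i => y M i ≠ x i)
        (fun M hM M' hM' h => (hdisj hM hM' h).mono (filter_subset _ _) (filter_subset _ _))
        (fun M hM => (filter_subset _ _).trans (hc M (hF' M hM).1).1) fun M hM => ?_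
      have hflip : flip x (M.filter fun i => y M i ≠ x i) = y M := by
        funext i
        by_cases hi : i ∈ M
        · by_cases h : y M i = x i
          · simp [flip, h]
          · have : y M i = !x i := by cases hyi : y M i <;> cases hxi : x i <;> simp_all
            simp [flip, hi, this]
        · simp [flip, hi, hyM M hM i hi]
      rw [hflip]
      refine (hf _ fun i hi => ?_).1 (hy M hM)
      rw [hyM M hM i fun h => hi ((hc M (hF' M hM).1).1 h), hxs i hi]
    have hH : #(F.biUnion id) ≤ N * (k + 1) := by
      refine (card_biUnion_le).trans ?_
      refine (sum_le_card_nsmul _ _ (k + 1) fun M hM => (hF' M hM).2.le).trans ?_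
      exact Nat.mul_le_mul_right _ hcard
    have hHs : F.biUnion id ⊆ s := biUnion_subset.2 fun M hM => (hc M (hF' M hM).1).1
    set H := F.biUnion id
    obtain ⟨T, hT, hTf⟩ := exists_decisionTree_query_all (f := f) (m := k ^ 2 * N) (s \ H) H z (by
      intro z' hz'
      obtain ⟨c', hc', hcc'⟩ := exists_multilin_restrict c H z'
      refine ih (s \ H) z' c' (fun S' hS' => ?_) fun w hw => ?_
      · obtain ⟨S, hS, rfl⟩ := hc' S' hS'
        refine ⟨sdiff_subset_sdiff (hc S hS).1 subset_rfl, ?_⟩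
        -- Monomials of size `k + 1` meet `H` by maximality of the family, so each loses a variable.
        rcases (hc S hS).2.lt_or_eq with h | h
        · exact (card_le_card sdiff_subset).trans (Nat.lt_succ_iff.1 h)
        · obtain ⟨i, hi, hiH⟩ := hhit S (by simp [hS, h]) (card_pos.1 (by omega))
          have : #(S \ H) < #S := card_lt_card
            ⟨sdiff_subset, fun hsub => (mem_sdiff.1 (hsub hi)).2 hiH⟩
          omega
      · rw [← hcc' w fun i hi => hw i fun h => (mem_sdiff.1 h).2 hi]
        refine hf w fun i hi => ?_
        rw [hw i fun h => hi (mem_sdiff.1 h).1, hz' i fun h => hi (hHs h)])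
    refine ⟨T, hT.trans ?_, fun w hw => hTf w fun i hi hiH => hw i fun h => hi (mem_sdiff.2 ⟨h, hiH⟩)⟩
    -- `N * (k + 1) + k² * N ≤ (k + 1)² * N`.
    nlinarith

/-! ### The two bounds -/

theorem D_le {n : ℕ} {ε : ℝ} (hε0 : 0 ≤ ε) (hε1 : ε < 1) (f : BoolFun n) :
    (D f : ℝ) ≤ 2 / (1 - ε) * (approxNdeg ε f : ℝ) ^ 2 * (ndeg (neg f) : ℝ) ^ 2 := by
  obtain ⟨p₀, hp₀⟩ := exists_approxNondetRep hε0 f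
  obtain ⟨q₀, hq₀⟩ := exists_nondetRep (neg f)
  obtain ⟨p, hp, hpd⟩ := Nat.sInf_mem
    (s := {d | ∃ p : MvPolynomial (Fin n) ℝ, IsApproxNondetRep ε f p ∧ p.totalDegree = d})
    ⟨_, p₀, hp₀, rfl⟩
  obtain ⟨q, hq, hqd⟩ := Nat.sInf_mem
    (s := {d | ∃ p : MvPolynomial (Fin n) ℝ, IsNondetRep (neg f) p ∧ p.totalDegree = d})
    ⟨_, q₀, hq₀, rfl⟩
  obtain ⟨a, ha, hpa⟩ := exists_multilin_eq_eval p
  obtain ⟨b, hb, hqb⟩ := exists_multilin_eq_eval q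
  change p.totalDegree = approxNdeg ε f at hpd
  change q.totalDegree = ndeg (neg f) at hqd
  rw [hpd] at ha
  rw [hqd] at hb
  obtain ⟨T, hT, hTf⟩ := exists_decisionTree_depth_le
    (hasOneInputs_of_approx hε0 hε1 ha (fun x hx => hpa x ▸ (hp x).1 hx)
      (fun x hx => hpa x ▸ (hp x).2 hx) rfl) (ndeg (neg f)) univ (fun _ => false) b
    (fun S hS => ⟨subset_univ S, hb S hS⟩) (fun x _ => by
      rw [← hqb, hq.2 x, neg, Bool.not_eq_true'])
  have hD : D f ≤ T.depth := Nat.sInf_le ⟨T, fun x => hTf x fun i hi => absurd (mem_univ i) hi, rfl⟩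
  have hfl : ((⌊2 * (approxNdeg ε f : ℝ) ^ 2 / (1 - ε)⌋₊ : ℕ) : ℝ) ≤
      2 * (approxNdeg ε f : ℝ) ^ 2 / (1 - ε) :=
    Nat.floor_le (div_nonneg (by positivity) (by linarith))
  calc (D f : ℝ) ≤ ((ndeg (neg f) ^ 2 * ⌊2 * (approxNdeg ε f : ℝ) ^ 2 / (1 - ε)⌋₊ : ℕ) : ℝ) :=
        Nat.cast_le.2 (hD.trans hT)
    _ ≤ (ndeg (neg f) : ℝ) ^ 2 * (2 * (approxNdeg ε f : ℝ) ^ 2 / (1 - ε)) := by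
        rw [Nat.cast_mul, Nat.cast_pow]
        exact mul_le_mul_of_nonneg_left hfl (by positivity)
    _ = _ := by ring

theorem neg_neg_eq {n : ℕ} (f : BoolFun n) : neg (neg f) = f := by
  funext x
  simp [neg]

/-- The tree with all its outputs negated. -/
def DecisionTree.negate {n : ℕ} : DecisionTree n → DecisionTree n
  | .leaf b => .leaf (!b)
  | .query i s t => .query i s.negate t.negate

theorem DecisionTree.depth_negate {n : ℕ} (T : DecisionTree n) : T.negate.depth = T.depth := by
  induction T with
  | leaf b => rfl
  | query i s t hs ht => simp [DecisionTree.negate, DecisionTree.depth, hs, ht]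

theorem DecisionTree.eval_negate {n : ℕ} (x : Fin n → Bool) (T : DecisionTree n) :
    T.negate.eval x = !(T.eval x) := by
  induction T with
  | leaf b => rfl
  | query i s t hs ht =>
    simp only [DecisionTree.negate, DecisionTree.eval, hs, ht]
    split_ifs <;> rfl

theorem D_le_D_neg {n : ℕ} (f : BoolFun n) : D f ≤ D (neg f) := by
  obtain ⟨T₀, hT₀⟩ := exists_decisionTree (neg f)
  obtain ⟨T, hT, hd⟩ := Nat.sInf_mem
    (s := {d | ∃ T : DecisionTree n, T.Computes (neg f) ∧ T.depth = d}) ⟨_, T₀, hT₀, rfl⟩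
  have hf : T.negate.Computes f := fun x => by rw [T.eval_negate, hT x, neg, Bool.not_not]
  have h : D f ≤ T.depth := Nat.sInf_le ⟨T.negate, hf, T.depth_negate⟩
  exact h.trans hd.le

end BooleanComplexity
end

theorem mainTheorem9 (ε : ℝ) (hε0 : 0 ≤ ε) (hε1 : ε < 1) :
    ∃ C : ℝ, ∀ (n : ℕ) (_hn : 0 < n) (f : BooleanComplexity.BoolFun n),
      (BooleanComplexity.D f : ℝ) ≤
        C * (BooleanComplexity.approxNdeg ε f : ℝ) ^ 2 *
          (BooleanComplexity.ndeg (BooleanComplexity.neg f) : ℝ) ^ 2 ∧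
      (BooleanComplexity.D f : ℝ) ≤
        C * (BooleanComplexity.ndeg f : ℝ) ^ 2 *
          (BooleanComplexity.approxNdeg ε (BooleanComplexity.neg f) : ℝ) ^ 2 := by
  refine ⟨2 / (1 - ε), fun n _ f => ⟨BooleanComplexity.D_le hε0 hε1 f, ?_⟩⟩
  have h := BooleanComplexity.D_le hε0 hε1 (BooleanComplexity.neg f)
  rw [BooleanComplexity.neg_neg_eq, mul_right_comm] at h
  exact (Nat.cast_le.2 (BooleanComplexity.D_le_D_neg f)).trans h
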